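/- Let $p,d\ge 1$ and let $\mu$ be a probability measure on a closed and bounded set $K\subset\mathbb{R}^p$ with $0\in K$; write $\|h\|=(\int |h|^2\,d\mu)^{1/2}$. Let $\phi:\mathbb{R}\to\mathbb{R}$ be a sigmoidal function (finite limits $l<u$ at $-\infty,+\infty$) that is bounded and Lipschitz, with bounded derivative. For $\theta=(u_i,v_i,\tau_i,\tau_0)_{i\le m}$ with $u_i\in\mathbb{R}^k$, $v_i,\tau_i,\tau_0\in\mathbb{R}$, and for $w\in\mathbb{R}^{p\times k}$, let $$f_{k,m}(x,\theta,w)=\sum_{i=1}^m\tau_i\,\phi(u_i^Tw^Tx+v_i)+\tau_0$$ be the network of two hidden layers of widths $k$ and $m$, with the identity as activation and no bias in the first layer. Let $f:\mathbb{R}^p\to\mathbb{R}$ be measurable, $g:\mathbb{R}^d\to\mathbb{R}$, $\beta_d\in\mathbb{R}^{p\times d}$ and $0<\delta_N<c_N$ be such that $\|f(\cdot)-g(\beta_d^T\cdot)\|\le\delta_N$, and $\|f(\cdot)-\tilde g(\alpha^T\cdot)\|\ge c_N$ for every measurable $\tilde g:\mathbb{R}^{d-1}\to\mathbb{R}$ and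 every $\alpha\in\mathbb{R}^{p\times(d-1)}$ (for $d=1$: for every constant in place of $\tilde g(\alpha^T\cdot)$). Let $g$ be in the Barron class: $g$ is integrable, $g(z)=\int_{\mathbb{R}^d}e^{2\pi i\eta^Tz}\tilde g(\eta)\,d\eta$ for all $z$, where now $\tilde g(\eta)=\int_{\mathbb{R}^d} e^{-2\pi i\eta^Tz}g(z)\,dz$, and $$C_g=\int_{\mathbb{R}^d}\|2\pi\eta\|_1\,|\tilde g(\eta)|\,d\eta<\infty$$ ($2\pi\eta$ is the angular frequency). Then: 1. If $\beta_d^TK\subset[-r,r]^d$, then for every $m\ge1$ there is $\bar\theta$ with $$\|f(\cdot)-f_{d,m}(\cdot,\bar\theta,\beta_d)\|<\delta_N+\frac{2rC_g}{\sqrt m};$$ in particular the bound is $\delta_N+2C_g/\sqrt m$ when $\beta_d^TK\subset[-1,1]^d$. 2. For all $k\le d-1$, all $m$, all $\theta$ and all $\alpha_k\in\mathbb{R}^{p\times k}$, $$\|f(\cdot)-f_{k,m}(\cdot,\theta,\alpha_k)\|\ge c_N.$$ -/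

import Mathlib

open MeasureTheory Filter Topology
open scoped FourierTransform ENNReal Matrix

noncomputable section

/-- `ℝ^n`. -/
abbrev Vec (n : ℕ) : Type := EuclideanSpace ℝ (Fin n)

/-- The reduced predictor `wᵀ x ∈ ℝ^k` of `x ∈ ℝ^p`, for a matrix `w ∈ ℝ^{p × k}`. -/
def reduce {p k : ℕ} (w : Matrix (Fin p) (Fin k) ℝ) (x : Vec p) : Vec k :=
  WithLp.toLp 2 (wᵀ *ᵥ x.ofLp)

/-- The activation functions: sigmoidal, bounded, differentiable with bounded derivative, and
Lipschitz.  The two limits are allowed to be any `l < u`, which covers both the convention `0, 1`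
(logistic function) and the convention `-1, 1` (hyperbolic tangent). -/
structure IsSigmoidalActivation (φ : ℝ → ℝ) : Prop where
  limits : ∃ l u : ℝ, l < u ∧ Tendsto φ atBot (𝓝 l) ∧ Tendsto φ atTop (𝓝 u)
  differentiable : Differentiable ℝ φ
  deriv_bounded : ∃ b : ℝ, ∀ z, |deriv φ z| ≤ b
  lipschitz : ∃ a₁ : ℝ, 0 < a₁ ∧ ∀ z z', |φ z - φ z'| ≤ a₁ * |z - z'|
  bounded : ∃ a₀ : ℝ, 1 ≤ a₀ ∧ ∀ z, |φ z| ≤ a₀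

/-- The parameters `θ = {u_i, v_i, τ_i, τ_0 : i = 1, …, m}` of a one-hidden-layer network with `m`
nodes on `ℝ^k`. -/
structure NetParams (k m : ℕ) where
  u : Fin m → Vec k
  v : Fin m → ℝ
  τ : Fin m → ℝ
  τ₀ : ℝ

/-- The one-hidden-layer network `g_m(z, θ) = ∑ τ_i φ(u_iᵀ z + v_i) + τ_0`. -/
def oneLayerNet (φ : ℝ → ℝ) {k m : ℕ} (θ : NetParams k m) (z : Vec k) : ℝ :=
  (∑ i, θ.τ i * φ ((∑ j, θ.u i j * z j) + θ.v i)) + θ.τ₀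

/-- The two-hidden-layer network
`f_{k,m}(x, θ, w) = ∑ τ_i φ(u_iᵀ I(wᵀ x) + v_i) + τ_0`, whose first hidden layer has width `k`, the
identity `I` as activation and no bias. -/
def twoLayerNet (φ : ℝ → ℝ) {p k m : ℕ} (θ : NetParams k m) (w : Matrix (Fin p) (Fin k) ℝ)
    (x : Vec p) : ℝ :=
  oneLayerNet φ θ (id (reduce w x))

/-- The `L₂(μ)` distance `(∫ |f - h|² dμ)^{1/2}`, with values in `[0, ∞]`. -/
def l2Dist {p : ℕ} (μ : Measure (Vec p)) (f h : Vec p → ℝ) : ℝ≥0∞ :=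
  eLpNorm (fun x => f x - h x) 2 μ

/-- The Fourier transform `g̃(η) = ∫ e^{-2πi ηᵀz} g(z) dz`. -/
def fourierOf {d : ℕ} (g : Vec d → ℝ) : Vec d → ℂ :=
  𝓕 (fun z => (g z : ℂ))

/-- The `ℓ₁` norm of the angular frequency `ω = 2πη`. -/
def angularL1 {d : ℕ} (η : Vec d) : ℝ :=
  ∑ j, |2 * Real.pi * η j|

/-- `C_g`, the first absolute moment `∫ ‖2πη‖₁ |g̃(η)| dη` of the Fourier magnitude distribution
of `g`. -/
def barronConst {d : ℕ} (g : Vec d → ℝ) : ℝ :=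
  ∫ η, angularL1 η * ‖fourierOf g η‖

/-- The Barron class: `g` has an absolutely convergent Fourier representation
`g(z) = ∫ e^{2πi ηᵀz} g̃(η) dη`, and `C_g < ∞`. -/
structure InBarronClass {d : ℕ} (g : Vec d → ℝ) : Prop where
  integrable : Integrable g
  integrable_fourier : Integrable (fourierOf g)
  representation : ∀ z, (g z : ℂ) = 𝓕⁻ (fourierOf g) z
  finite_moment : Integrable (fun η => angularL1 η * ‖fourierOf g η‖)

/-- `f` is within `δ` of a function `g(βᵀ x)` of `d` linear combinations of the predictors, and, for
some `c > δ`, at distance at least `c` from every function `h(αᵀ x)` of `d - 1` linear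
combinations. -/
structure ApproxReduction {p : ℕ} (μ : Measure (Vec p)) (f : Vec p → ℝ) (d : ℕ)
    (g : Vec d → ℝ) (β : Matrix (Fin p) (Fin d) ℝ) (δ c : ℝ) : Prop where
  delta_pos : 0 < δ
  approx : l2Dist μ f (fun x => g (reduce β x)) ≤ ENNReal.ofReal δ
  delta_lt : δ < c
  separation : ∀ (h : Vec (d - 1) → ℝ), Measurable h → ∀ α : Matrix (Fin p) (Fin (d - 1)) ℝ,
    ENNReal.ofReal c ≤ l2Dist μ f (fun x => h (reduce α x))

end

/-! The lower bound is a remark: zero columns turn a network on `k ≤ d - 1` combinations into a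
measurable function of `d - 1` combinations, and the separation hypothesis applies.

The upper bound follows from the triangle inequality and Barron's argument for `g`. By Fourier
inversion, `g z - g 0` is an integral over frequencies of increments of sinusoids of the phase, and
each increment is its derivative integrated against unit jumps. Hence on the cube `g - g 0` is an
integral of weighted ridge jumps, bounded by `1`, against a measure of mass `b = 2 r C_g`
(`sub_eq_integral_ridge`). After normalization it is `b` times a mean `F`, and Maurey's sampling
argument (`exists_sample`) yields an average of `m` jumps with squared error at most `b² (1 - ‖F‖²)
/ m`.

This is strictly below `b² / m`: if `F` vanished almost everywhere, `g(βᵀx)` would be constant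
almost everywhere, which `δ < c` and the separation from constants exclude. The slack pays for
replacing the jumps by steep sigmoids (`exists_net_tendsto_jumps`), with no further loss in the
bound. -/

noncomputable section

/-! ### Approximation of a mean by an average of samples -/

section Sampling

variable {Ω X : Type*} [MeasurableSpace Ω] [MeasurableSpace X]

/-- One step of the derandomized sampling argument. -/
lemma exists_sample_step (Q : Measure Ω) [IsProbabilityMeasure Q]
    (μ : Measure X) [IsProbabilityMeasure μ] (H : Ω → X → ℝ)
    (hH : Measurable (Function.uncurry H)) (hH1 : ∀ ω x, |H ω x| ≤ 1)
    (S : X → ℝ) (hS : Measurable S) (B : ℝ) (hB : ∀ x, |S x| ≤ B) :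
    ∃ ω, ∫ x, (S x + (H ω x - ∫ ω', H ω' x ∂Q)) ^ 2 ∂μ ≤
      ∫ x, S x ^ 2 ∂μ + (1 - ∫ x, (∫ ω', H ω' x ∂Q) ^ 2 ∂μ) := by
  set F : X → ℝ := fun x => ∫ ω', H ω' x ∂Q with hF
  have hFm : Measurable F :=
    (StronglyMeasurable.integral_prod_left (f := fun ω x => H ω x) hH.stronglyMeasurable).measurable
  have hHx : ∀ x, Integrable (fun ω => H ω x) Q := fun x =>
    Integrable.of_bound (by fun_prop) 1 (.of_forall fun ω => hH1 ω x)
  have hHx2 : ∀ x, Integrable (fun ω => H ω x ^ 2) Q := fun x =>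
    Integrable.of_bound (by fun_prop) 1 (.of_forall fun ω => by
      rw [Real.norm_eq_abs, abs_pow]; exact pow_le_one₀ (abs_nonneg _) (hH1 ω x))
  have hF1 : ∀ x, |F x| ≤ 1 := fun x => by
    have := norm_integral_le_of_norm_le_const (μ := Q) (f := fun ω => H ω x) (C := 1)
      (.of_forall fun ω => hH1 ω x)
    simpa using this
  have hint : Integrable (Function.uncurry fun (ω : Ω) (x : X) => (S x + (H ω x - F x)) ^ 2)
      (Q.prod μ) := by
    refine Integrable.of_bound (Measurable.aestronglyMeasurable ?_) ((B + 2) ^ 2)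
      (.of_forall fun p => ?_)
    · have h2 : Measurable fun p : Ω × X => H p.1 p.2 := hH
      change Measurable fun p : Ω × X => (S p.2 + (H p.1 p.2 - F p.2)) ^ 2
      fun_prop
    · change |(S p.2 + (H p.1 p.2 - F p.2)) ^ 2| ≤ _
      rw [abs_pow]
      gcongr
      have h1 := abs_le.1 (hB p.2)
      have h2 := abs_le.1 (hH1 p.1 p.2)
      have h3 := abs_le.1 (hF1 p.2)
      exact abs_le.2 ⟨by linarith, by linarith⟩
  -- Some sample does no worse than the average over `Q`, which Fubini then lets one compute
  -- pointwise in `x`.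
  obtain ⟨ω, hω⟩ := exists_le_integral hint.integral_prod_left
  refine ⟨ω, (hω.trans (integral_integral_swap hint).le).trans ?_⟩
  have hS2 : Integrable (fun x => S x ^ 2) μ :=
    Integrable.of_bound (by fun_prop) (B ^ 2) (.of_forall fun x => by
      rw [Real.norm_eq_abs, abs_pow]
      exact pow_le_pow_left₀ (abs_nonneg _) (hB x) 2)
  have hF2 : Integrable (fun x => F x ^ 2) μ :=
    Integrable.of_bound (by fun_prop) 1 (.of_forall fun x => by
      rw [Real.norm_eq_abs, abs_pow]; exact pow_le_one₀ (abs_nonneg _) (hF1 x))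
  have hR : ∫ x, S x ^ 2 ∂μ + (1 - ∫ x, F x ^ 2 ∂μ) = ∫ x, (S x ^ 2 + (1 - F x ^ 2)) ∂μ := by
    have h1F : Integrable (fun x => 1 - F x ^ 2) μ := (integrable_const _).sub hF2
    rw [integral_add hS2 h1F, integral_sub (integrable_const _) hF2]
    simp
  rw [hR]
  refine integral_mono hint.integral_prod_right
    (hS2.add ((integrable_const _).sub hF2)) fun x => ?_
  have h1 : ∫ ω, H ω x ^ 2 ∂Q ≤ 1 := by
    have := integral_mono (hHx2 x) (integrable_const (1 : ℝ)) fun ω =>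
      (sq_le_one_iff_abs_le_one _).2 (hH1 ω x)
    simpa using this
  have h2 : ∫ ω, (S x + (H ω x - F x)) ^ 2 ∂Q
      = ∫ ω, ((S x - F x) ^ 2 + (2 * (S x - F x) * H ω x + H ω x ^ 2)) ∂Q := by
    congr 1; ext ω; ring
  change ∫ ω, (S x + (H ω x - F x)) ^ 2 ∂Q ≤ S x ^ 2 + (1 - F x ^ 2)
  have h3 : ∫ ω, 2 * (S x - F x) * H ω x ∂Q = 2 * (S x - F x) * F x := integral_const_mul _ _
  have i3 : Integrable (fun ω => 2 * (S x - F x) * H ω x) Q := (hHx x).const_mul _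
  have i4 : Integrable (fun ω => 2 * (S x - F x) * H ω x + H ω x ^ 2) Q := i3.add (hHx2 x)
  rw [h2, integral_add (integrable_const _) i4, integral_add i3 (hHx2 x), h3]
  simp only [integral_const, probReal_univ, one_smul]
  -- Since `H - F` has mean zero, the cross term with `S` cancels; what remains is the variance `∫
  -- H² - F² ≤ 1 - F²`.
  nlinarith

/-- The mean `F = ∫ H ω dQ(ω)` of functions bounded by `1` is approximated in `L₂(μ)` by an average
of `m` of them with squared error at most `(1 - ‖F‖²) / m`. -/
lemma exists_sample (Q : Measure Ω) [IsProbabilityMeasure Q]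
    (μ : Measure X) [IsProbabilityMeasure μ] (H : Ω → X → ℝ)
    (hH : Measurable (Function.uncurry H)) (hH1 : ∀ ω x, |H ω x| ≤ 1) (m : ℕ) :
    ∃ ω : Fin m → Ω, ∫ x, (∑ i, H (ω i) x - m * ∫ ω', H ω' x ∂Q) ^ 2 ∂μ ≤
      m * (1 - ∫ x, (∫ ω', H ω' x ∂Q) ^ 2 ∂μ) := by
  induction m with
  | zero => exact ⟨Fin.elim0, by simp⟩
  | succ m ih =>
    obtain ⟨ω, hω⟩ := ih
    have hFm : Measurable fun x => ∫ ω', H ω' x ∂Q :=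
      (StronglyMeasurable.integral_prod_left (f := fun ω x => H ω x)
        hH.stronglyMeasurable).measurable
    have hF1 : ∀ x, |∫ ω', H ω' x ∂Q| ≤ 1 := fun x => by
      have := norm_integral_le_of_norm_le_const (μ := Q) (f := fun ω => H ω x) (C := 1)
        (.of_forall fun ω => hH1 ω x)
      simpa using this
    obtain ⟨ω₀, h₀⟩ := exists_sample_step Q μ H hH hH1
      (fun x => ∑ i, H (ω i) x - m * ∫ ω', H ω' x ∂Q) (by fun_prop) (m + m) fun x => by
        refine (abs_sub _ _).trans (add_le_add ?_ ?_)
        · refine (Finset.abs_sum_le_sum_abs _ _).trans ?_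
          simpa using Finset.sum_le_sum (s := Finset.univ) fun i _ => hH1 (ω i) x
        · rw [abs_mul, Nat.abs_cast]
          exact mul_le_of_le_one_right (Nat.cast_nonneg _) (hF1 x)
    refine ⟨Fin.snoc ω ω₀, ?_⟩
    have : ∀ x, ∑ i, H ((Fin.snoc ω ω₀ : Fin (m + 1) → Ω) i) x - ((m + 1 : ℕ) : ℝ) * ∫ ω', H ω' x ∂Q
        = (∑ i, H (ω i) x - m * ∫ ω', H ω' x ∂Q) + (H ω₀ x - ∫ ω', H ω' x ∂Q) := fun x => by
      rw [Fin.sum_univ_castSucc]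
      simp only [Fin.snoc_castSucc, Fin.snoc_last]
      push_cast
      ring
    simp only [this]
    push_cast
    linarith

end Sampling

/-! ### Steps and their sigmoidal approximations -/

/-- The step at `t`, normalized to vanish at `s = 0`. -/
def jump (t s : ℝ) : ℝ := (if t < s then 1 else 0) - (if t < 0 then 1 else 0)

lemma abs_jump_le (t s : ℝ) : |jump t s| ≤ 1 := by
  unfold jump; split_ifs <;> norm_num

lemma measurable_jump : Measurable fun q : ℝ × ℝ => jump q.1 q.2 := by
  unfold jump
  exact (Measurable.ite (measurableSet_lt measurable_fst measurable_snd)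
    measurable_const measurable_const).sub
    (Measurable.ite (measurableSet_lt measurable_fst measurable_const)
    measurable_const measurable_const)

/-- The increments of a `C¹` function on `[-ρ, ρ]` as mixtures of jumps. -/
lemma integral_jump_mul_deriv (P P' : ℝ → ℝ) (hP : ∀ t, HasDerivAt P (P' t) t)
    (hP' : Continuous P') {ρ s : ℝ} (hs : |s| ≤ ρ) :
    ∫ t in -ρ..ρ, jump t s * P' t = P s - P 0 := by
  have hρ : 0 ≤ ρ := (abs_nonneg s).trans hs
  have key : ∀ a, |a| ≤ ρ →
      IntervalIntegrable (fun t => (if t < a then 1 else 0) * P' t) volume (-ρ) ρ ∧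
      ∫ t in -ρ..ρ, (if t < a then 1 else 0) * P' t = P a - P (-ρ) := by
    intro a ha
    have ha' := abs_le.1 ha
    have h1 : Set.EqOn (fun t => (if t < a then 1 else 0) * P' t) P' (Set.Ioo (-ρ) a) := by
      intro t ht; simp [ht.2]
    have h2 : Set.EqOn (fun t => (if t < a then 1 else 0) * P' t) (fun _ => 0) (Set.Ioo a ρ) := by
      intro t ht; simp [not_lt.2 ht.1.le]
    have i1 : IntervalIntegrable (fun t => (if t < a then 1 else 0) * P' t) volume (-ρ) a := by
      refine (hP'.intervalIntegrable _ _).congr_uIoo ?_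
      rw [Set.uIoo_of_le ha'.1]; exact h1.symm
    have i2 : IntervalIntegrable (fun t => (if t < a then 1 else 0) * P' t) volume a ρ := by
      refine (intervalIntegrable_const (c := (0 : ℝ))).congr_uIoo ?_
      rw [Set.uIoo_of_le ha'.2]; exact h2.symm
    refine ⟨i1.trans i2, ?_⟩
    rw [← intervalIntegral.integral_add_adjacent_intervals i1 i2,
      intervalIntegral.integral_congr_Ioo_of_le ha'.1 h1,
      intervalIntegral.integral_congr_Ioo_of_le ha'.2 h2,
      intervalIntegral.integral_eq_sub_of_hasDerivAt (fun t _ => hP t)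
        (hP'.intervalIntegrable _ _)]
    simp
  obtain ⟨i1, e1⟩ := key s hs
  obtain ⟨i0, e0⟩ := key 0 (by simpa using hρ)
  simp only [jump, sub_mul]
  rw [intervalIntegral.integral_sub i1 i0, e1, e0]
  ring

/-- A rescaled form of `integral_jump_mul_deriv`, with a parameter interval that does not depend
on the scale `L`. -/
lemma integral_jump_mul_deriv_scaled (P P' : ℝ → ℝ) (hP : ∀ t, HasDerivAt P (P' t) t)
    (hP' : Continuous P') {r s L : ℝ} (hs : |s| ≤ r * L) :
    ∫ t in -r..r, L * (jump (t * L) s * P' (t * L)) = P s - P 0 := by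
  rw [intervalIntegral.integral_const_mul]
  have := intervalIntegral.smul_integral_comp_mul_right (a := -r) (b := r)
    (fun t => jump t s * P' t) L
  rw [smul_eq_mul] at this
  rw [this, neg_mul, integral_jump_mul_deriv P P' hP hP' hs]

/-- A sigmoidal function with a large slope and a shift of lower order approximates the step
everywhere, the location of the jump included. -/
lemma tendsto_sigmoid_step {φ : ℝ → ℝ} {l u : ℝ} (hl : Tendsto φ atBot (𝓝 l))
    (hu : Tendsto φ atTop (𝓝 u)) (y : ℝ) :
    Tendsto (fun n : ℕ => φ ((n : ℝ) ^ 2 * y - n)) atTop (𝓝 (if 0 < y then u else l)) := by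
  have hn : Tendsto (fun n : ℕ => (n : ℝ)) atTop atTop := tendsto_natCast_atTop_atTop
  split_ifs with hy
  · refine hu.comp ?_
    -- The slope `n²` beats the shift `n` when `y > 0`; at `y = 0` the shift alone drives the
    -- argument to `-∞`.
    have : Tendsto (fun n : ℕ => (n : ℝ) * ((n : ℝ) * y - 1)) atTop atTop :=
      hn.atTop_mul_atTop₀ (tendsto_atTop_add_const_right _ _ (hn.atTop_mul_const hy))
    exact this.congr fun n => by ring
  · refine hl.comp ?_
    refine tendsto_atBot_mono (fun n => ?_) (tendsto_neg_atTop_atBot.comp hn)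
    have : (n : ℝ) ^ 2 * y ≤ 0 := mul_nonpos_of_nonneg_of_nonpos (by positivity) (not_lt.1 hy)
    simp only [Function.comp]
    linarith

lemma eLpNorm_two_lt_of_integral_sq_lt {X : Type*} [MeasurableSpace X] {μ : Measure X}
    {h : X → ℝ} (hh : MemLp h 2 μ) {e : ℝ} (he : 0 < e) (hlt : ∫ x, h x ^ 2 ∂μ < e ^ 2) :
    eLpNorm h 2 μ < ENNReal.ofReal e := by
  rw [hh.eLpNorm_eq_integral_rpow_norm (by norm_num) (by norm_num)]
  refine (ENNReal.ofReal_lt_ofReal_iff he).2 ?_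
  have : ∫ x, ‖h x‖ ^ (2 : ℝ≥0∞).toReal ∂μ = ∫ x, h x ^ 2 ∂μ := by simp
  rw [this]
  have h2 : ((2 : ℝ≥0∞).toReal)⁻¹ = 1 / 2 := by norm_num
  rw [h2, ← Real.sqrt_eq_rpow]
  exact (Real.sqrt_lt' he).2 hlt

/-! ### The Fourier representation as a mixture of jumps -/

section Barron

variable {d : ℕ}

/-- The phase `ωᵀ z` at the angular frequency `ω = 2πη`. -/
def phase (η z : Vec d) : ℝ := ∑ j, 2 * Real.pi * η j * z j

lemma angularL1_nonneg (η : Vec d) : 0 ≤ angularL1 η :=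
  Finset.sum_nonneg fun _ _ => abs_nonneg _

lemma continuous_angularL1 : Continuous (angularL1 : Vec d → ℝ) := by
  unfold angularL1; fun_prop

lemma abs_phase_le {r : ℝ} (η z : Vec d) (hz : ∀ j, |z j| ≤ r) :
    |phase η z| ≤ r * angularL1 η := by
  unfold phase angularL1
  refine (Finset.abs_sum_le_sum_abs _ _).trans ?_
  rw [Finset.mul_sum]
  refine Finset.sum_le_sum fun j _ => ?_
  rw [abs_mul, mul_comm]
  exact mul_le_mul_of_nonneg_right (hz j) (abs_nonneg _)

lemma continuous_fourierOf {g : Vec d → ℝ} (hg : Integrable g) : Continuous (fourierOf g) :=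
  VectorFourier.fourierIntegral_continuous Real.continuous_fourierChar
    continuous_inner hg.ofReal

/-- The real part of `c e^{it}`. -/
def wave (c : ℂ) (t : ℝ) : ℝ := c.re * Real.cos t - c.im * Real.sin t

/-- The derivative of `wave c`. -/
def waveDeriv (c : ℂ) (t : ℝ) : ℝ := -(c.re * Real.sin t + c.im * Real.cos t)

lemma hasDerivAt_wave (c : ℂ) (t : ℝ) : HasDerivAt (wave c) (waveDeriv c t) t := by
  have := ((Real.hasDerivAt_cos t).const_mul c.re).sub ((Real.hasDerivAt_sin t).const_mul c.im)
  refine this.congr_deriv ?_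
  unfold waveDeriv; ring

lemma continuous_waveDeriv : Continuous fun q : ℂ × ℝ => waveDeriv q.1 q.2 := by
  unfold waveDeriv; fun_prop

/-- `wave c t` and `waveDeriv c t` are, up to sign, the real and imaginary parts of the rotated
number `c e^{it}`, so their squares sum to `‖c‖²`. -/
lemma abs_waveDeriv_le (c : ℂ) (t : ℝ) : |waveDeriv c t| ≤ ‖c‖ := by
  refine abs_le_of_sq_le_sq ?_ (norm_nonneg c)
  rw [← Complex.normSq_eq_norm_sq, Complex.normSq_apply]
  unfold waveDeriv
  nlinarith [Real.sin_sq_add_cos_sq t, sq_nonneg (c.re * Real.cos t - c.im * Real.sin t)]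

lemma re_exp_mul (c : ℂ) (t : ℝ) : (Complex.exp (t * Complex.I) * c).re = wave c t := by
  simp [wave, Complex.exp_mul_I, Complex.cos_ofReal_re, Complex.sin_ofReal_re]
  ring

lemma integrable_wave_and_eq {g : Vec d → ℝ} (hg : InBarronClass g) (z : Vec d) :
    Integrable (fun η => wave (fourierOf g η) (phase η z)) ∧
      g z = ∫ η, wave (fourierOf g η) (phase η z) := by
  have hphase : ∀ η : Vec d, 2 * Real.pi * inner ℝ η z = phase η z := fun η => by
    simp only [phase, PiLp.inner_apply, Finset.mul_sum]
    refine Finset.sum_congr rfl fun j _ => ?_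
    simp
    ring
  have hint : Integrable fun η : Vec d =>
      Complex.exp ((phase η z : ℝ) * Complex.I) * fourierOf g η := by
    refine hg.integrable_fourier.bdd_mul (c := 1) ?_ (.of_forall fun η => ?_)
    · refine Continuous.aestronglyMeasurable ?_
      unfold phase; fun_prop
    · rw [Complex.norm_exp_ofReal_mul_I]
  have hre := hg.representation z
  rw [Real.fourierInv_eq'] at hre
  simp only [hphase, smul_eq_mul] at hre
  have h2 := congrArg Complex.re hre
  have h3 : ∫ η, (Complex.exp ((phase η z : ℝ) * Complex.I) * fourierOf g η).re
      = (∫ η, Complex.exp ((phase η z : ℝ) * Complex.I) * fourierOf g η).re := integral_re hint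
  rw [← h3, Complex.ofReal_re] at h2
  simp only [re_exp_mul] at h2
  refine ⟨?_, h2⟩
  exact hint.re.congr (.of_forall fun η => re_exp_mul _ _)

/-- The measure `‖2πη‖₁ |g̃(η)| dη dτ` on frequencies and normalized locations `τ ∈ (-r, r]`. -/
def barronMeasure (g : Vec d → ℝ) (r : ℝ) : Measure (Vec d × ℝ) :=
  (volume.withDensity fun η => ENNReal.ofReal (angularL1 η * ‖fourierOf g η‖)).prod
    (volume.restrict (Set.Ioc (-r) r))

/-- This mass is the source of the constant `2 r C_g`. Measuring locations in units of `angularL1 η`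
makes the measure a product. -/
lemma barronMeasure_univ {g : Vec d → ℝ} (hg : InBarronClass g) (r : ℝ) :
    barronMeasure g r Set.univ =
      ENNReal.ofReal (barronConst g) * ENNReal.ofReal (2 * r) := by
  rw [barronMeasure, ← Set.univ_prod_univ, Measure.prod_prod, withDensity_apply _ .univ,
    Measure.restrict_univ, Measure.restrict_apply_univ, Real.volume_Ioc,
    ← ofReal_integral_eq_lintegral_ofReal hg.finite_moment
      (.of_forall fun η => mul_nonneg (angularL1_nonneg η) (norm_nonneg _))]
  congr 2
  ring

/-- The normalized amplitude of the jump at frequency `q.1` and normalized location `q.2`. -/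
def amplitude (g : Vec d → ℝ) (q : Vec d × ℝ) : ℝ :=
  waveDeriv (fourierOf g q.1) (q.2 * angularL1 q.1) / ‖fourierOf g q.1‖

lemma abs_amplitude_le (g : Vec d → ℝ) (q : Vec d × ℝ) : |amplitude g q| ≤ 1 := by
  rw [amplitude, abs_div, abs_norm]
  exact div_le_one_of_le₀ (abs_waveDeriv_le _ _) (norm_nonneg _)

lemma measurable_amplitude {g : Vec d → ℝ} (hg : Integrable g) : Measurable (amplitude g) := by
  have h1 := continuous_fourierOf hg
  have h2 := continuous_angularL1 (d := d)
  have h3 : Continuous fun q : Vec d × ℝ =>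
      waveDeriv (fourierOf g q.1) (q.2 * angularL1 q.1) :=
    continuous_waveDeriv.comp (by fun_prop :
      Continuous fun q : Vec d × ℝ => (fourierOf g q.1, q.2 * angularL1 q.1))
  exact h3.measurable.div (by fun_prop : Continuous fun q : Vec d × ℝ =>
    ‖fourierOf g q.1‖).measurable

/-- The weighted jump with parameters `q`, as a function of `z`. -/
def ridge (g : Vec d → ℝ) (q : Vec d × ℝ) (z : Vec d) : ℝ :=
  amplitude g q * jump (q.2 * angularL1 q.1) (phase q.1 z)

lemma abs_ridge_le (g : Vec d → ℝ) (q : Vec d × ℝ) (z : Vec d) : |ridge g q z| ≤ 1 := by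
  rw [ridge, abs_mul]
  exact mul_le_one₀ (abs_amplitude_le g q) (abs_nonneg _) (abs_jump_le _ _)

lemma measurable_ridge {g : Vec d → ℝ} (hg : Integrable g) :
    Measurable (Function.uncurry (ridge g)) := by
  have h2 := continuous_angularL1 (d := d)
  have h4 : Continuous fun q : (Vec d × ℝ) × Vec d =>
      (q.1.2 * angularL1 q.1.1, phase q.1.1 q.2) := by
    unfold phase; fun_prop
  exact ((measurable_amplitude hg).comp measurable_fst).mul
    (measurable_jump.comp h4.measurable)

/-- On the cube the phase at `η` stays within `r * angularL1 η`, so jumps located in that range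
recover the whole increment of the sinusoid. The density cancels the denominator of the amplitude
and supplies the Jacobian of the rescaled location. -/
lemma sub_eq_integral_ridge {g : Vec d → ℝ} (hg : InBarronClass g) {r : ℝ} (hr : 0 ≤ r)
    {z : Vec d} (hz : ∀ j, |z j| ≤ r) :
    g z - g 0 = ∫ q, ridge g q z ∂barronMeasure g r := by
  have hfin : IsFiniteMeasure (barronMeasure g r) := ⟨by
    rw [barronMeasure_univ hg]
    exact ENNReal.mul_lt_top ENNReal.ofReal_lt_top ENNReal.ofReal_lt_top⟩
  have hD : Measurable fun η => ENNReal.ofReal (angularL1 η * ‖fourierOf g η‖) :=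
    (continuous_angularL1.mul (continuous_fourierOf hg.integrable).norm).measurable.ennreal_ofReal
  have hint : Integrable (fun q => ridge g q z) (barronMeasure g r) :=
    Integrable.of_bound ((measurable_ridge hg.integrable).comp
      (measurable_id.prodMk measurable_const)).aestronglyMeasurable 1
      (.of_forall fun q => abs_ridge_le g q z)
  rw [barronMeasure] at hint ⊢
  rw [integral_prod _ hint,
    integral_withDensity_eq_integral_toReal_smul hD (.of_forall fun _ => ENNReal.ofReal_lt_top)]
  obtain ⟨iz, ez⟩ := integrable_wave_and_eq hg z
  obtain ⟨i0, e0⟩ := integrable_wave_and_eq hg 0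
  rw [ez, e0, ← integral_sub iz i0]
  refine integral_congr_ae (.of_forall fun η => ?_)
  have h0 : phase η 0 = 0 := by simp [phase]
  have hL := angularL1_nonneg η
  simp only [h0, smul_eq_mul]
  rw [ENNReal.toReal_ofReal (mul_nonneg hL (norm_nonneg _)),
    ← intervalIntegral.integral_of_le (by linarith),
    ← integral_jump_mul_deriv_scaled _ _ (hasDerivAt_wave (fourierOf g η))
      (continuous_waveDeriv.comp (by fun_prop : Continuous fun t : ℝ => (fourierOf g η, t)))
      (abs_phase_le η z hz), ← intervalIntegral.integral_const_mul]
  refine intervalIntegral.integral_congr fun τ _ => ?_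
  simp only [ridge, amplitude]
  -- Where the transform vanishes, the amplitude is `0 / 0 = 0` and the sinusoid is zero as well.
  rcases eq_or_ne (fourierOf g η) 0 with hc | hc
  · simp [hc, waveDeriv]
  · have : ‖fourierOf g η‖ ≠ 0 := norm_ne_zero_iff.2 hc
    field_simp

end Barron

/-! ### Networks -/

section Networks

variable {p k m : ℕ}

lemma continuous_reduce (w : Matrix (Fin p) (Fin k) ℝ) : Continuous (reduce w) :=
  (PiLp.continuous_toLp 2 _).comp
    (Continuous.matrix_mulVec continuous_const (PiLp.continuous_ofLp 2 _))

lemma IsSigmoidalActivation.continuous {φ : ℝ → ℝ} (hφ : IsSigmoidalActivation φ) :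
    Continuous φ := hφ.differentiable.continuous

lemma continuous_oneLayerNet {φ : ℝ → ℝ} (hφ : Continuous φ) (θ : NetParams k m) :
    Continuous (oneLayerNet φ θ) := by
  unfold oneLayerNet; fun_prop

/-- A combination of jumps is a pointwise limit of uniformly bounded networks. -/
lemma exists_net_tendsto_jumps {φ : ℝ → ℝ} (hφ : IsSigmoidalActivation φ) (A : ℝ)
    (a t : Fin m → ℝ) (η : Fin m → Vec k) :
    ∃ (θ : ℕ → NetParams k m) (B : ℝ), (∀ n z, |oneLayerNet φ (θ n) z| ≤ B) ∧
      ∀ z, Tendsto (fun n => oneLayerNet φ (θ n) z) atTop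
        (𝓝 (A + ∑ i, a i * jump (t i) (phase (η i) z))) := by
  obtain ⟨l, u, hlu, hl, hu⟩ := hφ.limits
  obtain ⟨a₀, -, ha₀⟩ := hφ.bounded
  have hul : u - l ≠ 0 := (sub_pos.2 hlu).ne'
  -- The unit step is `(φ - l) / (u - l)` in the limit; the output bias absorbs the offset `l` and
  -- the normalization of each jump at `0`.
  set A₀ : ℝ := A + ∑ i, a i * (-(if t i < 0 then 1 else 0) - l / (u - l)) with hA₀
  refine ⟨fun n =>
    { u := fun i => WithLp.toLp 2 fun j => (n : ℝ) ^ 2 * (2 * Real.pi * η i j)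
      v := fun i => -((n : ℝ) ^ 2 * t i) - n
      τ := fun i => a i / (u - l)
      τ₀ := A₀ }, ∑ i, |a i / (u - l)| * a₀ + |A₀|, fun n z => ?_, fun z => ?_⟩
  · refine (abs_add_le _ _).trans (add_le_add_left ?_ _)
    refine (Finset.abs_sum_le_sum_abs _ _).trans (Finset.sum_le_sum fun i _ => ?_)
    rw [abs_mul]
    exact mul_le_mul_of_nonneg_left (ha₀ _) (abs_nonneg _)
  · have hlim : A + ∑ i, a i * jump (t i) (phase (η i) z) =
        ∑ i, a i / (u - l) * (if 0 < phase (η i) z - t i then u else l) + A₀ := by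
      rw [hA₀, add_left_comm, ← Finset.sum_add_distrib]
      congr 1
      refine Finset.sum_congr rfl fun i _ => ?_
      simp only [jump, sub_pos]
      split_ifs <;> field_simp <;> ring
    rw [hlim]
    refine Tendsto.add_const _ (tendsto_finsetSum _ fun i _ => Tendsto.const_mul _ ?_)
    refine (tendsto_sigmoid_step hl hu (phase (η i) z - t i)).congr fun n => ?_
    congr 1
    have : ∑ j, (n : ℝ) ^ 2 * (2 * Real.pi * η i j) * z j = (n : ℝ) ^ 2 * phase (η i) z := by
      rw [phase, Finset.mul_sum]
      exact Finset.sum_congr rfl fun j _ => by ring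
    simp only [this]
    ring

/-- Narrow networks are functions of fewer linear combinations of the predictors. -/
lemma exists_reduction_of_le {φ : ℝ → ℝ} (hφ : Continuous φ) {n : ℕ} (hkn : k ≤ n)
    (θ : NetParams k m) (α : Matrix (Fin p) (Fin k) ℝ) :
    ∃ (h : Vec n → ℝ) (α' : Matrix (Fin p) (Fin n) ℝ), Measurable h ∧
      twoLayerNet φ θ α = fun x => h (reduce α' x) := by
  -- Pad `α` with zero columns and let the new function ignore the added coordinates.
  refine ⟨fun z => oneLayerNet φ θ (WithLp.toLp 2 fun j => z (Fin.castLE hkn j)),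
    Matrix.of fun i j => if hj : (j : ℕ) < k then α i ⟨j, hj⟩ else 0, ?_, ?_⟩
  · exact ((continuous_oneLayerNet hφ θ).comp (by fun_prop)).measurable
  · funext x
    simp only [twoLayerNet, id]
    congr 1
    ext j
    simp [reduce, Matrix.mulVec, dotProduct, Matrix.transpose_apply]

end Networks

/-! ### Barron's bound composed with the linear reduction -/

section Approximation

variable {p d : ℕ}

lemma measurable_ridge_reduce {g : Vec d → ℝ} (hg : Integrable g)
    (β : Matrix (Fin p) (Fin d) ℝ) :
    Measurable (Function.uncurry fun (q : Vec d × ℝ) (x : Vec p) => ridge g q (reduce β x)) := by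
  have h1 : Measurable (reduce β) := (continuous_reduce β).measurable
  have h2 : Measurable fun q : (Vec d × ℝ) × Vec p => (q.1, reduce β q.2) :=
    measurable_fst.prodMk (h1.comp measurable_snd)
  have h3 := (measurable_ridge hg).comp h2
  exact h3

/-- **Barron's bound** for the part of `f` that depends on `d` linear combinations. -/
lemma exists_net_eLpNorm_lt (K : Set (Vec p)) (μ : Measure (Vec p)) [IsProbabilityMeasure μ]
    (hμK : μ Kᶜ = 0) {φ : ℝ → ℝ} (hφ : IsSigmoidalActivation φ)
    {g : Vec d → ℝ} (hg : InBarronClass g) (β : Matrix (Fin p) (Fin d) ℝ)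
    (hne : ¬ ∀ᵐ x ∂μ, g (reduce β x) = g 0)
    {r : ℝ} (hr : 0 ≤ r) (hK : ∀ x ∈ K, ∀ j, |reduce β x j| ≤ r) {m : ℕ} (hm : 1 ≤ m) :
    ∃ θ : NetParams d m,
      AEStronglyMeasurable (fun x => g (reduce β x) - twoLayerNet φ θ β x) μ ∧
      eLpNorm (fun x => g (reduce β x) - twoLayerNet φ θ β x) 2 μ <
        ENNReal.ofReal (2 * r * barronConst g / Real.sqrt m) := by
  have hKae : ∀ᵐ x ∂μ, x ∈ K := hμK
  set b : ℝ := 2 * r * barronConst g with hb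
  have hC : 0 ≤ barronConst g :=
    integral_nonneg fun η => mul_nonneg (angularL1_nonneg η) (norm_nonneg _)
  set ν := barronMeasure g r with hν
  have hνb : ν Set.univ = ENNReal.ofReal b := by
    rw [hν, barronMeasure_univ hg, ← ENNReal.ofReal_mul hC, hb, mul_comm]
  have hfin : IsFiniteMeasure ν := ⟨by rw [hνb]; exact ENNReal.ofReal_lt_top⟩
  have hrep : ∀ x ∈ K, g (reduce β x) = g 0 + ∫ q, ridge g q (reduce β x) ∂ν := fun x hx => by
    rw [← sub_eq_integral_ridge hg hr (hK x hx)]; ring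
  have hbpos : 0 < b := by
    by_contra hb0
    have hν0 : ν = 0 := Measure.measure_univ_eq_zero.1 (by
      rw [hνb, ENNReal.ofReal_eq_zero]; exact not_lt.1 hb0)
    refine hne (hKae.mono fun x hx => ?_)
    rw [hrep x hx, hν0]; simp
  have hν0 : NeZero ν := ⟨fun h => by
    rw [h] at hνb
    exact (ENNReal.ofReal_pos.2 hbpos).ne hνb⟩
  set Q := (ν Set.univ)⁻¹ • ν with hQ
  have hQint : ∀ z, ∫ q, ridge g q z ∂ν = b * ∫ q, ridge g q z ∂Q := fun z => by
    rw [hQ, integral_smul_measure, hνb, ENNReal.toReal_inv, ENNReal.toReal_ofReal hbpos.le,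
      smul_eq_mul, mul_inv_cancel_left₀ hbpos.ne']
  have hHm : Measurable (Function.uncurry fun (q : Vec d × ℝ) (x : Vec p) =>
      ridge g q (reduce β x)) :=
    measurable_ridge_reduce hg.integrable β
  have hH1 : ∀ (q : Vec d × ℝ) (x : Vec p), |ridge g q (reduce β x)| ≤ 1 :=
    fun q x => abs_ridge_le g q _
  obtain ⟨ω, hω⟩ := exists_sample Q μ (fun q x => ridge g q (reduce β x)) hHm hH1 m
  set F : Vec p → ℝ := fun x => ∫ q, ridge g q (reduce β x) ∂Q with hF
  have hFm : Measurable F :=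
    (StronglyMeasurable.integral_prod_left (f := fun q x => ridge g q (reduce β x))
      hHm.stronglyMeasurable).measurable
  have hF1 : ∀ x, |F x| ≤ 1 := fun x => by
    have := norm_integral_le_of_norm_le_const (μ := Q) (f := fun q => ridge g q (reduce β x))
      (C := 1) (.of_forall fun q => hH1 q x)
    simpa using this
  have hgF : ∀ᵐ x ∂μ, g (reduce β x) = g 0 + b * F x := hKae.mono fun x hx => by
    rw [hrep x hx, hQint]
  -- The only source of strictness: it makes the sampling error strictly smaller than `b² / m`.
  have hF2pos : 0 < ∫ x, F x ^ 2 ∂μ := by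
    refine lt_of_le_of_ne (integral_nonneg fun x => sq_nonneg _) fun h0 => hne ?_
    have hF2 : Integrable (fun x => F x ^ 2) μ :=
      Integrable.of_bound (by fun_prop) 1 (.of_forall fun x => by
        rw [Real.norm_eq_abs, abs_pow]; exact pow_le_one₀ (abs_nonneg _) (hF1 x))
    filter_upwards [hgF, (integral_eq_zero_iff_of_nonneg (fun x => sq_nonneg (F x)) hF2).1 h0.symm]
      with x hx hx0
    have : F x = 0 := pow_eq_zero_iff (two_ne_zero) |>.1 hx0
    rw [hx, this]; ring
  have hm0 : (0 : ℝ) < m := by exact_mod_cast hm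
  obtain ⟨θ, B, hB, hlim⟩ := exists_net_tendsto_jumps hφ (g 0)
    (fun i => b / m * amplitude g (ω i)) (fun i => (ω i).2 * angularL1 (ω i).1)
    (fun i => (ω i).1)
  have hnetm : ∀ n, Measurable fun x => oneLayerNet φ (θ n) (reduce β x) := fun n =>
    ((continuous_oneLayerNet hφ.continuous (θ n)).comp (continuous_reduce β)).measurable
  have herrm : ∀ n, Measurable fun x => g 0 + b * F x - oneLayerNet φ (θ n) (reduce β x) :=
    fun n => (by fun_prop : Measurable fun x => g 0 + b * F x).sub (hnetm n)
  have herrb : ∀ n x, |g 0 + b * F x - oneLayerNet φ (θ n) (reduce β x)| ≤ |g 0| + b + B := by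
    intro n x
    refine (abs_sub _ _).trans (add_le_add ((abs_add_le _ _).trans ?_) (hB n _))
    rw [abs_mul, abs_of_pos hbpos]
    exact add_le_add_right (mul_le_of_le_one_right hbpos.le (hF1 x)) _
  -- Convergence holds at every point, the jump hyperplanes included, so `μ` may charge them.
  have hconv : Tendsto (fun n => ∫ x, (g 0 + b * F x - oneLayerNet φ (θ n) (reduce β x)) ^ 2 ∂μ)
      atTop (𝓝 (∫ x, (b / m) ^ 2 * (∑ i, ridge g (ω i) (reduce β x) - m * F x) ^ 2 ∂μ)) := by
    refine tendsto_integral_of_dominated_convergence (fun _ => (|g 0| + b + B) ^ 2)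
      (fun n => ((herrm n).pow_const 2).aestronglyMeasurable) (integrable_const _)
      (fun n => .of_forall fun x => ?_) (.of_forall fun x => ?_)
    · rw [Real.norm_eq_abs, abs_pow]
      exact pow_le_pow_left₀ (abs_nonneg _) (herrb n x) 2
    · have heq : (b / m) ^ 2 * (∑ i, ridge g (ω i) (reduce β x) - m * F x) ^ 2 =
          (g 0 + b * F x - (g 0 + ∑ i, b / m * amplitude g (ω i) *
            jump ((ω i).2 * angularL1 (ω i).1) (phase (ω i).1 (reduce β x)))) ^ 2 := by
        have hs : ∑ i, b / m * amplitude g (ω i) *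
            jump ((ω i).2 * angularL1 (ω i).1) (phase (ω i).1 (reduce β x)) =
            b / m * ∑ i, ridge g (ω i) (reduce β x) := by
          rw [Finset.mul_sum]
          exact Finset.sum_congr rfl fun i _ => by rw [ridge]; ring
        rw [hs]
        field_simp
        ring
      rw [heq]
      exact ((hlim _).const_sub _).pow 2
  have hlt : ∫ x, (b / m) ^ 2 * (∑ i, ridge g (ω i) (reduce β x) - m * F x) ^ 2 ∂μ <
      (b / Real.sqrt m) ^ 2 := by
    rw [integral_const_mul, div_pow b (Real.sqrt m), Real.sq_sqrt hm0.le]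
    calc (b / m) ^ 2 * ∫ x, (∑ i, ridge g (ω i) (reduce β x) - m * F x) ^ 2 ∂μ
        ≤ (b / m) ^ 2 * (m * (1 - ∫ x, F x ^ 2 ∂μ)) := by gcongr
      _ < (b / m) ^ 2 * (m * 1) := by gcongr; linarith
      _ = b ^ 2 / m := by field_simp
  -- The limit lies strictly below the target, so some finite steepness already does.
  obtain ⟨n, hn⟩ := (hconv.eventually_lt_const hlt).exists
  have hae : (fun x => g (reduce β x) - twoLayerNet φ (θ n) β x) =ᵐ[μ]
      fun x => g 0 + b * F x - oneLayerNet φ (θ n) (reduce β x) := hgF.mono fun x hx => by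
    simp only [hx, twoLayerNet, id]
  refine ⟨θ n, (herrm n).aestronglyMeasurable.congr hae.symm, ?_⟩
  rw [eLpNorm_congr_ae hae]
  exact eLpNorm_two_lt_of_integral_sq_lt
    (MemLp.of_bound (herrm n).aestronglyMeasurable _ (.of_forall fun x => herrb n x))
    (div_pos hbpos (Real.sqrt_pos.2 hm0)) hn

end Approximation

end

theorem proposition3 {p d : ℕ} (hd : 1 ≤ d)
    (K : Set (Vec p)) (hK : IsCompact K) (hK0 : 0 ∈ K)
    (μ : Measure (Vec p)) [IsProbabilityMeasure μ] (hμK : μ Kᶜ = 0)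
    (φ : ℝ → ℝ) (hφ : IsSigmoidalActivation φ)
    (f : Vec p → ℝ) (hf : AEStronglyMeasurable f μ)
    (g : Vec d → ℝ) (β : Matrix (Fin p) (Fin d) ℝ) (δ c : ℝ)
    (hfg : ApproxReduction μ f d g β δ c) (hg : InBarronClass g) :
    (∀ r : ℝ, (∀ x ∈ K, ∀ j, |reduce β x j| ≤ r) → ∀ m : ℕ, 1 ≤ m →
      ∃ θ : NetParams d m,
        l2Dist μ f (twoLayerNet φ θ β) <
          ENNReal.ofReal (δ + 2 * r * barronConst g / Real.sqrt m)) ∧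
    (∀ (k m : ℕ), k ≤ d - 1 → ∀ (θ : NetParams k m) (α : Matrix (Fin p) (Fin k) ℝ),
      ENNReal.ofReal c ≤ l2Dist μ f (twoLayerNet φ θ α)) := by
  have hcpos : 0 < c := hfg.delta_pos.trans hfg.delta_lt
  refine ⟨fun r hr m hm => ?_, fun k m hk θ α => ?_⟩
  · have hr0 : 0 ≤ r := (abs_nonneg _).trans (hr 0 hK0 ⟨0, hd⟩)
    -- A constant is an admissible competitor in the separation hypothesis, so it cannot agree with
    -- `g(βᵀx)`, which is within `δ < c` of `f`.
    have hne : ¬ ∀ᵐ x ∂μ, g (reduce β x) = g 0 := fun h => by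
      have h1 := hfg.separation (fun _ => g 0) measurable_const 0
      have h2 : l2Dist μ f (fun _ => g 0) = l2Dist μ f (fun x => g (reduce β x)) :=
        eLpNorm_congr_ae (h.mono fun x hx => by simp only [hx])
      exact absurd ((h1.trans_eq h2).trans hfg.approx)
        (not_le.2 ((ENNReal.ofReal_lt_ofReal_iff hcpos).2 hfg.delta_lt))
    obtain ⟨θ, hθm, hθ⟩ := exists_net_eLpNorm_lt K μ hμK hφ hg β hne hr0 hr hm
    refine ⟨θ, ?_⟩
    have hnet : AEStronglyMeasurable (twoLayerNet φ θ β) μ :=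
      ((continuous_oneLayerNet hφ.continuous θ).comp
        (continuous_reduce β)).aestronglyMeasurable
    -- Measurability of `f - g(βᵀx)` comes from subtracting the network from both terms.
    have hfgm : AEStronglyMeasurable (fun x => f x - g (reduce β x)) μ :=
      ((hf.sub hnet).sub hθm).congr (.of_forall fun x => by simp)
    have hsum : (fun x => f x - twoLayerNet φ θ β x) =
        (fun x => f x - g (reduce β x)) + fun x => g (reduce β x) - twoLayerNet φ θ β x := by
      funext x; simp
    have hC : 0 ≤ barronConst g :=
      integral_nonneg fun η => mul_nonneg (angularL1_nonneg η) (norm_nonneg _)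
    rw [ENNReal.ofReal_add hfg.delta_pos.le (by positivity), l2Dist, hsum]
    exact (eLpNorm_add_le hfgm hθm (by norm_num)).trans_lt
      (ENNReal.add_lt_add_of_le_of_lt
        (hfg.approx.trans_lt ENNReal.ofReal_lt_top).ne hfg.approx hθ)
  · obtain ⟨h, α', hh, he⟩ := exists_reduction_of_le hφ.continuous hk θ α
    rw [he]
    exact hfg.separation h hh α'
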